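/- Let $\Omega\subset\mathbb R^n$ be a bounded domain (open, connected, nonempty), fix the homogeneous Dirichlet or the homogeneous Neumann boundary condition, and let $-\Delta$ act on the functions in $H^2(\Omega)$ satisfying it (the Neumann condition $\partial u/\partial n=0$ is understood as $\int_\Omega(\nabla u\cdot\nabla\psi+\psi\,\Delta u)\,dx=0$ for all $\psi\in H^1(\Omega)$; the Dirichlet condition as $u\in H^1_0(\Omega)$). Consider $$u_t=D_u\Delta u+f(u,v),\qquad v_t=D_v\Delta v+g(u,v)$$ with $D_u,D_v>0$, both components satisfying the boundary condition, where $f,g:\mathbb R^2\to\mathbb R$ are differentiable at $(0,0)$ and $f(0,0)=g(0,0)=0$. Let $A=(a_{ij})=\begin{pmatrix}f_u&f_v\\ g_u&g_v\end{pmatrix}(0,0)$. The system is called *Turing unstable* if every eigenvalue of $A$ has negative real part while the linearized operator $(u,v)\mapsto(D_u\Delta u+a_{11}u+a_{12}v,\;D_v\Delta v+a_{21}u+a_{22}v)$, on complex-valued pairs $(u,v)$ in $H^2(\Omega)^2$ satisfying the boundary condition, has an eigenvalue with positive real part. Assume $\det A>0$ and $\operatorname{Tr}A<0$, and fix $D_u>0$.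 Put $$h(\lambda)=h_{D_v}(\lambda)=D_uD_v\lambda^2-(a_{11}D_v+a_{22}D_u)\lambda+\det A,\qquad M_\lambda=\begin{pmatrix}a_{11}-\lambda D_u&a_{12}\\a_{21}&a_{22}-\lambda D_v\end{pmatrix},$$ $$q=4D_u\det A-2a_{11}a_{22}D_u,\qquad D_v^0=\frac{q+\sqrt{q^2-4a_{11}^2a_{22}^2D_u^2}}{2a_{11}^2},\qquad k_c^0=\frac{a_{11}D_v^0+a_{22}D_u}{2D_uD_v^0},$$ and suppose that $D_v^0$ is well defined and positive. Suppose that $\lambda_i<\lambda_{i+1}$ are two consecutive (distinct) eigenvalues of $-\Delta$ such that $$\lambda_i<k_c^0<\lambda_{i+1},\qquad \det M_{\lambda_i}>0,\qquad \det M_{\lambda_{i+1}}>0,$$ the determinants being taken at $D_v=D_v^0$. For $j\in\{i,i+1\}$ let $D_v^{\lambda_j}$ be the positive root $D_v$ of the equation $h_{D_v}(\lambda_j)=0$ (which is affine in $D_v$), with $D_v^{\lambda_j}=+\infty$ if there is no positive root, and let $$D_v^*=\min\{D_v^{\lambda_i},D_v^{\lambda_{i+1}}\}\in(0,+\infty].$$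 Then, for every $D_v>0$, the system is Turing unstable if and only if $D_v>D_v^*$. -/

import Mathlib

open MeasureTheory Filter Topology
open scoped ContDiff

namespace TuringRD

noncomputable section

/-- `ℝⁿ` with its Euclidean structure. -/
abbrev E (n : ℕ) : Type := EuclideanSpace ℝ (Fin n)

/-- The two homogeneous boundary conditions. -/
inductive BoundaryCondition
  | dirichlet
  | neumann

/-- Classical partial derivative `∂φ/∂xᵢ`. -/
def partialDeriv {n : ℕ} (i : Fin n) (φ : E n → ℂ) (x : E n) : ℂ :=
  fderiv ℝ φ x (EuclideanSpace.single i (1 : ℝ))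

/-- `φ ∈ C_c^∞(Ω)`. -/
def IsTestFunction {n : ℕ} (Ω : Set (E n)) (φ : E n → ℂ) : Prop :=
  ContDiff ℝ ∞ φ ∧ HasCompactSupport φ ∧ tsupport φ ⊆ Ω

/-- `g` is the weak partial derivative `∂u/∂xᵢ` in `Ω`. -/
def HasWeakPartial {n : ℕ} (Ω : Set (E n)) (i : Fin n) (u g : E n → ℂ) : Prop :=
  ∀ φ : E n → ℂ, IsTestFunction Ω φ →
    ∫ x in Ω, u x * partialDeriv i φ x = - ∫ x in Ω, g x * φ x

/-- `u ∈ H¹(Ω)` with weak gradient `G`. -/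
def HasH1Gradient {n : ℕ} (Ω : Set (E n)) (u : E n → ℂ) (G : Fin n → E n → ℂ) : Prop :=
  MemLp u 2 (volume.restrict Ω) ∧
    ∀ i, MemLp (G i) 2 (volume.restrict Ω) ∧ HasWeakPartial Ω i u (G i)

/-- `u` (with weak gradient `G`) lies in `H¹₀(Ω)`, the closure of `C_c^∞(Ω)` in `H¹(Ω)`. -/
def VanishesOnBoundary {n : ℕ} (Ω : Set (E n)) (u : E n → ℂ) (G : Fin n → E n → ℂ) : Prop :=
  ∃ φ : ℕ → E n → ℂ, (∀ k, IsTestFunction Ω (φ k)) ∧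
    Tendsto (fun k => eLpNorm (fun x => φ k x - u x) 2 (volume.restrict Ω)) atTop (𝓝 0) ∧
    ∀ i, Tendsto (fun k => eLpNorm (fun x => partialDeriv i (φ k) x - G i x) 2
      (volume.restrict Ω)) atTop (𝓝 0)

/-- A function with weak gradient `G` and Laplacian `w` has vanishing normal derivative on `∂Ω`,
expressed by Green's formula: `∫_Ω (∇u · ∇ψ + ψ Δu) = ∫_{∂Ω} ψ ∂u/∂n = 0` for all
`ψ ∈ H¹(Ω)`. -/
def NormalDerivVanishes {n : ℕ} (Ω : Set (E n)) (G : Fin n → E n → ℂ) (w : E n → ℂ) : Prop :=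
  ∀ (ψ : E n → ℂ) (Ψ : Fin n → E n → ℂ), HasH1Gradient Ω ψ Ψ →
    ∫ x in Ω, ((∑ i, G i x * Ψ i x) + w x * ψ x) = 0

/-- `u ∈ H²(Ω)` satisfies the boundary condition `bc` and `Δu = w` almost everywhere in `Ω`. -/
def HasLaplacian {n : ℕ} (Ω : Set (E n)) (bc : BoundaryCondition) (u w : E n → ℂ) : Prop :=
  ∃ (G : Fin n → E n → ℂ) (K : Fin n → Fin n → E n → ℂ),
    HasH1Gradient Ω u G ∧ (∀ i, HasH1Gradient Ω (G i) (K i)) ∧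
    w =ᵐ[volume.restrict Ω] (fun x => ∑ i, K i i x) ∧
    match bc with
    | .dirichlet => VanishesOnBoundary Ω u G
    | .neumann => NormalDerivVanishes Ω G w

/-- `lam` is an eigenvalue of `-Δ` on `Ω` under the boundary condition `bc`. -/
def IsLaplaceEigenvalue {n : ℕ} (Ω : Set (E n)) (bc : BoundaryCondition) (lam : ℝ) : Prop :=
  ∃ e w : E n → ℂ, HasLaplacian Ω bc e w ∧ ¬ (e =ᵐ[volume.restrict Ω] 0) ∧
    ∀ᵐ x ∂(volume.restrict Ω), - w x = (lam : ℂ) * e x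

/-- `lam < lam'` are two consecutive terms in the increasing list of eigenvalues of `-Δ`. -/
def AreConsecutiveEigenvalues {n : ℕ} (Ω : Set (E n)) (bc : BoundaryCondition)
    (lam lam' : ℝ) : Prop :=
  IsLaplaceEigenvalue Ω bc lam ∧ IsLaplaceEigenvalue Ω bc lam' ∧ lam < lam' ∧
    ∀ μ : ℝ, IsLaplaceEigenvalue Ω bc μ → μ ≤ lam ∨ lam' ≤ μ

/-- The Jacobian matrix at `(0,0)` of the reaction terms `(f, g)`. -/
def jacobian (f g : ℝ → ℝ → ℝ) : Matrix (Fin 2) (Fin 2) ℝ :=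
  !![deriv (fun u => f u 0) 0, deriv (fun v => f 0 v) 0;
     deriv (fun u => g u 0) 0, deriv (fun v => g 0 v) 0]

/-- `(u, v) ↦ (Du Δu + a₁₁u + a₁₂v, Dv Δv + a₂₁u + a₂₂v)`, acting on the (complexified) space of
pairs in `H²(Ω)` satisfying the boundary condition, has the eigenvalue `β ∈ ℂ`. -/
def IsLinearizationEigenvalue {n : ℕ} (Ω : Set (E n)) (bc : BoundaryCondition)
    (A : Matrix (Fin 2) (Fin 2) ℝ) (Du Dv : ℝ) (β : ℂ) : Prop :=
  ∃ u v wu wv : E n → ℂ, HasLaplacian Ω bc u wu ∧ HasLaplacian Ω bc v wv ∧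
    ¬ (u =ᵐ[volume.restrict Ω] 0 ∧ v =ᵐ[volume.restrict Ω] 0) ∧
    ∀ᵐ x ∂(volume.restrict Ω),
      (Du : ℂ) * wu x + (A 0 0 : ℂ) * u x + (A 0 1 : ℂ) * v x = β * u x ∧
      (Dv : ℂ) * wv x + (A 1 0 : ℂ) * u x + (A 1 1 : ℂ) * v x = β * v x

/-- The steady state `(0,0)` is linearly stable for the kinetics `u' = f(u,v)`, `v' = g(u,v)`
without diffusion. -/
def IsKineticallyStable (f g : ℝ → ℝ → ℝ) : Prop :=
  ∀ z : ℂ, Module.End.HasEigenvalue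
    (Matrix.toLin' ((jacobian f g).map (algebraMap ℝ ℂ))) z → z.re < 0

/-- Turing (diffusion-driven) instability of the steady state `(0,0)` of
`u_t = Du Δu + f(u,v)`, `v_t = Dv Δv + g(u,v)` in `Ω`: it is stable without diffusion, while the
linearization with diffusion has an eigenvalue with positive real part. -/
def IsTuringUnstable {n : ℕ} (Ω : Set (E n)) (bc : BoundaryCondition)
    (f g : ℝ → ℝ → ℝ) (Du Dv : ℝ) : Prop :=
  IsKineticallyStable f g ∧
    ∃ β : ℂ, IsLinearizationEigenvalue Ω bc (jacobian f g) Du Dv β ∧ 0 < β.re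

/-- The matrix `M_lam` of the linearization on the eigenspace of `-Δ` for `lam`. -/
def modeMatrix (A : Matrix (Fin 2) (Fin 2) ℝ) (Du Dv lam : ℝ) : Matrix (Fin 2) (Fin 2) ℝ :=
  !![A 0 0 - lam * Du, A 0 1; A 1 0, A 1 1 - lam * Dv]

/-- The polynomial `h(lam) = Du Dv lam² - (a₁₁ Dv + a₂₂ Du) lam + det A`. -/
def hPoly (A : Matrix (Fin 2) (Fin 2) ℝ) (Du Dv lam : ℝ) : ℝ :=
  Du * Dv * lam ^ 2 - (A 0 0 * Dv + A 1 1 * Du) * lam + A.det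

/-- `q = 4 Du det A - 2 a₁₁ a₂₂ Du`. -/
def qCoeff (A : Matrix (Fin 2) (Fin 2) ℝ) (Du : ℝ) : ℝ :=
  4 * Du * A.det - 2 * A 0 0 * A 1 1 * Du

/-- `D_v⁰`, the larger root of `a₁₁² d² - q d + a₂₂² Du² = 0`; for this diffusion coefficient the
minimum of `h` over `ℝ` is zero. -/
def Dv0 (A : Matrix (Fin 2) (Fin 2) ℝ) (Du : ℝ) : ℝ :=
  (qCoeff A Du + Real.sqrt (qCoeff A Du ^ 2 - 4 * A 0 0 ^ 2 * A 1 1 ^ 2 * Du ^ 2)) /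
    (2 * A 0 0 ^ 2)

/-- `k_c⁰`, the point where `h` is minimal when `D_v = D_v⁰`. -/
def kc0 (A : Matrix (Fin 2) (Fin 2) ℝ) (Du : ℝ) : ℝ :=
  (A 0 0 * Dv0 A Du + A 1 1 * Du) / (2 * Du * Dv0 A Du)

/-- `D_v^lam`: the positive number `d` with `h(lam) = 0` for `D_v = d` (the equation is affine in
`d`); it is `+∞` if there is no such positive `d`. -/
def DvRoot (A : Matrix (Fin 2) (Fin 2) ℝ) (Du lam : ℝ) : EReal :=
  sInf ((fun d : ℝ => (d : EReal)) '' {d : ℝ | 0 < d ∧ hPoly A Du d lam = 0})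

/-- `D_v^* = min {D_v^lam, D_v^lam'}`. -/
def DvStar (A : Matrix (Fin 2) (Fin 2) ℝ) (Du lam lam' : ℝ) : EReal :=
  min (DvRoot A Du lam) (DvRoot A Du lam')

end

end TuringRD

/-!
Write the eigenvalue equation of the linearization as `ΔU = B U` with a constant matrix `B`.
Splitting the characteristic polynomial of `B` into linear factors extracts from `U` a scalar
eigenfunction of `-Δ`, whose eigenvalue is real and nonnegative by Green's formula. So the
linearization has exactly the eigenvalues of the matrices `M_λ`, `λ` an eigenvalue of `-Δ`. As
`Tr M_λ < 0`, there is one with positive real part iff `h(λ) = det M_λ < 0` for some such `λ`.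

By convexity `{h < 0}` is an interval. For fixed `λ ≥ 0` the number `h_d(λ)` is affine in `d` and
positive at `d = 0`, hence negative exactly for `d > D_v^λ`; and at `D_v⁰` the quadratic `h` is
`D_u D_v⁰ (λ - k_c⁰)²`. So if `h_d` is negative somewhere on `[0, ∞)`, then `d > D_v⁰` and
`h_d(k_c⁰) < 0`; the interval `{h_d < 0}` then contains an eigenvalue of `-Δ` only if it contains
one of the two neighbours of `k_c⁰`.
-/

namespace TuringRD

open scoped Matrix

section Lp

variable {α ι F 𝕜 : Type*} [MeasurableSpace α] {μ : Measure α} {l : Filter ι} {p : ENNReal}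
  [RCLike 𝕜] [NormedAddCommGroup F]

lemma tendsto_eLpNorm_add_sub_add [Fact (1 ≤ p)] {f g : ι → α → F} {f' g' : α → F}
    (hf : ∀ k, MemLp (f k) p μ) (hg : ∀ k, MemLp (g k) p μ) (hf' : MemLp f' p μ)
    (hg' : MemLp g' p μ) (hff' : Tendsto (fun k => eLpNorm (f k - f') p μ) l (𝓝 0))
    (hgg' : Tendsto (fun k => eLpNorm (g k - g') p μ) l (𝓝 0)) :
    Tendsto (fun k => eLpNorm (f k + g k - (f' + g')) p μ) l (𝓝 0) := by
  rw [← Lp.tendsto_Lp_iff_tendsto_eLpNorm'' _ hf _ hf'] at hff'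
  rw [← Lp.tendsto_Lp_iff_tendsto_eLpNorm'' _ hg _ hg'] at hgg'
  exact (Lp.tendsto_Lp_iff_tendsto_eLpNorm'' _ (fun k => (hf k).add (hg k)) _ (hf'.add hg')).1
    (hff'.add hgg')

lemma tendsto_eLpNorm_smul_sub_smul [NormedSpace 𝕜 F] (c : 𝕜) {f : ι → α → F} {f' : α → F}
    (hff' : Tendsto (fun k => eLpNorm (f k - f') p μ) l (𝓝 0)) :
    Tendsto (fun k => eLpNorm (c • f k - c • f') p μ) l (𝓝 0) := by
  simp only [← smul_sub, eLpNorm_const_smul]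
  simpa using ENNReal.Tendsto.const_mul (a := ‖c‖ₑ) hff' (Or.inr enorm_ne_top)

lemma tendsto_integral_mul_of_tendsto_eLpNorm {f g' : α → 𝕜} {g : ι → α → 𝕜} (hf : MemLp f 2 μ)
    (hg : ∀ k, MemLp (g k) 2 μ) (hg' : MemLp g' 2 μ)
    (hgg' : Tendsto (fun k => eLpNorm (g k - g') 2 μ) l (𝓝 0)) :
    Tendsto (fun k => ∫ x, f x * g k x ∂μ) l (𝓝 (∫ x, f x * g' x ∂μ)) := by
  have hinner {q : α → 𝕜} (hq : MemLp q 2 μ) :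
      inner 𝕜 (hf.star.toLp (star f)) (hq.toLp q) = ∫ x, f x * q x ∂μ := by
    rw [L2.inner_def]
    refine integral_congr_ae ?_
    filter_upwards [hf.star.coeFn_toLp, hq.coeFn_toLp] with x hfx hqx
    simp [hfx, hqx, mul_comm]
  simpa only [hinner] using (tendsto_const_nhds (x := hf.star.toLp (star f))).inner (𝕜 := 𝕜)
    ((Lp.tendsto_Lp_iff_tendsto_eLpNorm'' _ hg _ hg').2 hgg')

lemma integral_add_mul {f g h : α → 𝕜} (hf : MemLp f 2 μ) (hg : MemLp g 2 μ) (hh : MemLp h 2 μ) :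
    ∫ x, (f + g) x * h x ∂μ = ∫ x, f x * h x ∂μ + ∫ x, g x * h x ∂μ := by
  simp only [Pi.add_apply, add_mul]
  exact integral_add (hf.integrable_mul hh) (hg.integrable_mul hh)

lemma integral_sum_mul_add_mul [Fintype ι] {f g : ι → α → 𝕜} {a b : α → 𝕜}
    (hf : ∀ i, MemLp (f i) 2 μ) (hg : ∀ i, MemLp (g i) 2 μ) (ha : MemLp a 2 μ)
    (hb : MemLp b 2 μ) :
    ∫ x, ((∑ i, f i x * g i x) + a x * b x) ∂μ =
      (∑ i, ∫ x, f i x * g i x ∂μ) + ∫ x, a x * b x ∂μ := by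
  have hint i : Integrable (fun x => f i x * g i x) μ := (hf i).integrable_mul (hg i)
  rw [← integral_finsetSum _ fun i _ => hint i]
  exact integral_add (integrable_finsetSum _ fun i _ => hint i) (ha.integrable_mul hb)

lemma integral_mul_star_self (f : α → 𝕜) :
    ∫ x, f x * star (f x) ∂μ = ((∫ x, ‖f x‖ ^ 2 ∂μ : ℝ) : 𝕜) := by
  simp only [RCLike.star_def, RCLike.mul_conj, ← RCLike.ofReal_pow, integral_ofReal]

lemma integral_norm_sq_pos {f : α → F} (hf : MemLp f 2 μ) (hne : ¬ f =ᵐ[μ] 0) :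
    0 < ∫ x, ‖f x‖ ^ 2 ∂μ := by
  refine (integral_nonneg fun x => sq_nonneg ‖f x‖).lt_of_ne' fun h => hne ?_
  rw [integral_eq_zero_iff_of_nonneg (fun x => sq_nonneg ‖f x‖) hf.norm.integrable_sq] at h
  filter_upwards [h] with x hx
  simpa using hx

end Lp

section TestFunction

variable {n : ℕ} {Ω : Set (E n)} {φ ψ : E n → ℂ}

lemma partialDeriv_add (hφ : Differentiable ℝ φ) (hψ : Differentiable ℝ ψ) (i : Fin n) :
    partialDeriv i (φ + ψ) = partialDeriv i φ + partialDeriv i ψ := by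
  ext x
  simp [partialDeriv, fderiv_add (hφ x) (hψ x)]

lemma partialDeriv_const_smul (c : ℂ) (hφ : Differentiable ℝ φ) (i : Fin n) :
    partialDeriv i (c • φ) = c • partialDeriv i φ := by
  ext x
  simp [partialDeriv, fderiv_const_smul (hφ x)]

lemma partialDeriv_star (φ : E n → ℂ) (i : Fin n) :
    partialDeriv i (star φ) = star (partialDeriv i φ) := by
  ext x
  exact congrArg (· (EuclideanSpace.single i 1)) (fderiv_star (𝕜 := ℝ) (f := φ) (x := x))

namespace IsTestFunction

lemma zero : IsTestFunction Ω 0 :=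
  ⟨contDiff_const, .zero, by simp [tsupport]⟩

lemma add (hφ : IsTestFunction Ω φ) (hψ : IsTestFunction Ω ψ) : IsTestFunction Ω (φ + ψ) :=
  ⟨hφ.1.add hψ.1, hφ.2.1.add hψ.2.1,
    (tsupport_add φ ψ).trans (Set.union_subset hφ.2.2 hψ.2.2)⟩

lemma const_smul (c : ℂ) (hφ : IsTestFunction Ω φ) : IsTestFunction Ω (c • φ) :=
  ⟨hφ.1.const_smul c, hφ.2.1.smul_left (f := fun _ => c),
    (tsupport_smul_subset_right (fun _ => c) φ).trans hφ.2.2⟩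

protected lemma star (hφ : IsTestFunction Ω φ) : IsTestFunction Ω (star φ) :=
  ⟨Complex.conjCLE.contDiff.comp hφ.1, hφ.2.1.comp_left (g := star) (star_zero ℂ),
    (tsupport_comp_subset (g := star) (star_zero ℂ) φ).trans hφ.2.2⟩

lemma differentiable (hφ : IsTestFunction Ω φ) : Differentiable ℝ φ :=
  hφ.1.differentiable (by simp)

lemma memLp (hφ : IsTestFunction Ω φ) : MemLp φ 2 (volume.restrict Ω) :=
  hφ.1.continuous.memLp_of_hasCompactSupport hφ.2.1

lemma memLp_partialDeriv (hφ : IsTestFunction Ω φ) (i : Fin n) :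
    MemLp (partialDeriv i φ) 2 (volume.restrict Ω) :=
  ((hφ.1.continuous_fderiv (by simp)).clm_apply continuous_const).memLp_of_hasCompactSupport
    (hφ.2.1.fderiv_apply ℝ _)

end IsTestFunction

end TestFunction

section Sobolev

variable {n : ℕ} {Ω : Set (E n)} {u v w z : E n → ℂ} {G H : Fin n → E n → ℂ}

namespace HasH1Gradient

lemma zero : HasH1Gradient Ω 0 0 :=
  ⟨.zero, fun _ => ⟨.zero, fun φ _ => by simp⟩⟩

lemma add (hu : HasH1Gradient Ω u G) (hv : HasH1Gradient Ω v H) :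
    HasH1Gradient Ω (u + v) (G + H) := by
  refine ⟨hu.1.add hv.1, fun i => ⟨(hu.2 i).1.add (hv.2 i).1, fun φ hφ => ?_⟩⟩
  rw [integral_add_mul hu.1 hv.1 (hφ.memLp_partialDeriv i), Pi.add_apply,
    integral_add_mul (hu.2 i).1 (hv.2 i).1 hφ.memLp, (hu.2 i).2 φ hφ, (hv.2 i).2 φ hφ, neg_add]

lemma const_smul (c : ℂ) (hu : HasH1Gradient Ω u G) : HasH1Gradient Ω (c • u) (c • G) := by
  refine ⟨hu.1.const_smul c, fun i => ⟨(hu.2 i).1.const_smul c, fun φ hφ => ?_⟩⟩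
  simp only [Pi.smul_apply, smul_eq_mul, mul_assoc, integral_const_mul, (hu.2 i).2 φ hφ, mul_neg]

protected lemma star (hu : HasH1Gradient Ω u G) : HasH1Gradient Ω (star u) (star G) := by
  refine ⟨hu.1.star, fun i => ⟨(hu.2 i).1.star, fun φ hφ => ?_⟩⟩
  have h := congrArg (starRingEnd ℂ) ((hu.2 i).2 _ hφ.star)
  rw [map_neg, ← integral_conj, ← integral_conj] at h
  simpa [partialDeriv_star] using h

end HasH1Gradient

namespace VanishesOnBoundary

lemma zero : VanishesOnBoundary Ω 0 0 :=
  ⟨0, fun _ => .zero, by simp, fun i => by simp [partialDeriv]⟩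

lemma add (hu0 : VanishesOnBoundary Ω u G) (hv0 : VanishesOnBoundary Ω v H)
    (hu : HasH1Gradient Ω u G) (hv : HasH1Gradient Ω v H) :
    VanishesOnBoundary Ω (u + v) (G + H) := by
  obtain ⟨φ, hφ, hφu, hφG⟩ := hu0
  obtain ⟨ψ, hψ, hψv, hψH⟩ := hv0
  refine ⟨fun k => φ k + ψ k, fun k => (hφ k).add (hψ k),
    tendsto_eLpNorm_add_sub_add (fun k => (hφ k).memLp) (fun k => (hψ k).memLp) hu.1 hv.1 hφu hψv,
    fun i => ?_⟩
  simp only [partialDeriv_add (hφ _).differentiable (hψ _).differentiable]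
  exact tendsto_eLpNorm_add_sub_add (fun k => (hφ k).memLp_partialDeriv i)
    (fun k => (hψ k).memLp_partialDeriv i) (hu.2 i).1 (hv.2 i).1 (hφG i) (hψH i)

lemma const_smul (c : ℂ) (hu0 : VanishesOnBoundary Ω u G) :
    VanishesOnBoundary Ω (c • u) (c • G) := by
  obtain ⟨φ, hφ, hφu, hφG⟩ := hu0
  refine ⟨fun k => c • φ k, fun k => (hφ k).const_smul c, tendsto_eLpNorm_smul_sub_smul c hφu,
    fun i => ?_⟩
  simp only [partialDeriv_const_smul c (hφ _).differentiable]
  exact tendsto_eLpNorm_smul_sub_smul c (hφG i)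

protected lemma star (hu0 : VanishesOnBoundary Ω u G) :
    VanishesOnBoundary Ω (star u) (star G) := by
  have hconj {f : ℕ → E n → ℂ} {g : E n → ℂ}
      (h : Tendsto (fun k => eLpNorm (f k - g) 2 (volume.restrict Ω)) atTop (𝓝 0)) :
      Tendsto (fun k => eLpNorm (star (f k) - star g) 2 (volume.restrict Ω)) atTop (𝓝 0) := by
    simpa only [← star_sub, eLpNorm_star] using h
  obtain ⟨φ, hφ, hφu, hφG⟩ := hu0
  refine ⟨fun k => star (φ k), fun k => (hφ k).star, hconj hφu, fun i => ?_⟩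
  simp only [partialDeriv_star]
  exact hconj (hφG i)

end VanishesOnBoundary

namespace NormalDerivVanishes

lemma zero : NormalDerivVanishes Ω (0 : Fin n → E n → ℂ) 0 :=
  fun ψ Ψ _ => by simp

lemma add (hu : NormalDerivVanishes Ω G w) (hv : NormalDerivVanishes Ω H z)
    (hG : ∀ i, MemLp (G i) 2 (volume.restrict Ω)) (hH : ∀ i, MemLp (H i) 2 (volume.restrict Ω))
    (hw : MemLp w 2 (volume.restrict Ω)) (hz : MemLp z 2 (volume.restrict Ω)) :
    NormalDerivVanishes Ω (G + H) (w + z) := by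
  intro ψ Ψ hψ
  have hgreen {K : Fin n → E n → ℂ} {y : E n → ℂ} (hK : ∀ i, MemLp (K i) 2 (volume.restrict Ω))
      (hy : MemLp y 2 (volume.restrict Ω)) :
      Integrable (fun x => (∑ i, K i x * Ψ i x) + y x * ψ x) (volume.restrict Ω) :=
    (integrable_finsetSum _ fun i _ => (hK i).integrable_mul (hψ.2 i).1).add
      (hy.integrable_mul hψ.1)
  rw [← add_zero 0]
  nth_rewrite 1 [← hu ψ Ψ hψ]
  rw [← hv ψ Ψ hψ, ← integral_add (hgreen hG hw) (hgreen hH hz)]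
  congr with x
  simp only [Pi.add_apply, add_mul, Finset.sum_add_distrib]
  ring

lemma const_smul (c : ℂ) (hu : NormalDerivVanishes Ω G w) :
    NormalDerivVanishes Ω (c • G) (c • w) := by
  intro ψ Ψ hψ
  simp only [Pi.smul_apply, smul_eq_mul, mul_assoc, ← Finset.mul_sum, ← mul_add,
    integral_const_mul, hu ψ Ψ hψ, mul_zero]

end NormalDerivVanishes

lemma IsTestFunction.integral_green_eq_zero {K : Fin n → Fin n → E n → ℂ} {φ : E n → ℂ}
    (hφ : IsTestFunction Ω φ) (hG : ∀ i, HasH1Gradient Ω (G i) (K i))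
    (hw : w =ᵐ[volume.restrict Ω] fun x => ∑ i, K i i x) (hw2 : MemLp w 2 (volume.restrict Ω)) :
    ∫ x in Ω, ((∑ i, G i x * partialDeriv i φ x) + w x * φ x) = 0 := by
  have hdiv : ∫ x in Ω, w x * φ x = ∑ i, ∫ x in Ω, K i i x * φ x := by
    refine .trans (integral_congr_ae ?_)
      (integral_finsetSum _ fun i _ => ((hG i).2 i).1.integrable_mul hφ.memLp)
    filter_upwards [hw] with x hx
    simp [hx, Finset.sum_mul]
  rw [integral_sum_mul_add_mul (fun i => (hG i).1) hφ.memLp_partialDeriv hw2 hφ.memLp, hdiv,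
    ← Finset.sum_add_distrib]
  exact Finset.sum_eq_zero fun i _ => by rw [((hG i).2 i).2 φ hφ, neg_add_cancel]

lemma VanishesOnBoundary.integral_green_eq_zero {K : Fin n → Fin n → E n → ℂ}
    (hv0 : VanishesOnBoundary Ω v H) (hv : HasH1Gradient Ω v H)
    (hG : ∀ i, HasH1Gradient Ω (G i) (K i))
    (hw : w =ᵐ[volume.restrict Ω] fun x => ∑ i, K i i x) (hw2 : MemLp w 2 (volume.restrict Ω)) :
    ∫ x in Ω, ((∑ i, G i x * H i x) + w x * v x) = 0 := by
  obtain ⟨φ, hφ, hφv, hφH⟩ := hv0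
  have hlim : Tendsto (fun k => (∑ i, ∫ x in Ω, G i x * partialDeriv i (φ k) x) +
      ∫ x in Ω, w x * φ k x) atTop
      (𝓝 ((∑ i, ∫ x in Ω, G i x * H i x) + ∫ x in Ω, w x * v x)) :=
    (tendsto_finsetSum _ fun i _ => tendsto_integral_mul_of_tendsto_eLpNorm (hG i).1
      (fun k => (hφ k).memLp_partialDeriv i) (hv.2 i).1 (hφH i)).add
      (tendsto_integral_mul_of_tendsto_eLpNorm hw2 (fun k => (hφ k).memLp) hv.1 hφv)
  rw [integral_sum_mul_add_mul (fun i => (hG i).1) (fun i => (hv.2 i).1) hw2 hv.1]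
  refine tendsto_nhds_unique hlim (tendsto_const_nhds.congr fun k => ?_)
  rw [← (hφ k).integral_green_eq_zero hG hw hw2,
    integral_sum_mul_add_mul (fun i => (hG i).1) (hφ k).memLp_partialDeriv hw2 (hφ k).memLp]

namespace HasLaplacian

variable {bc : BoundaryCondition}

lemma memLp (hu : HasLaplacian Ω bc u w) : MemLp w 2 (volume.restrict Ω) := by
  obtain ⟨G, K, -, hG, hw, -⟩ := hu
  exact (memLp_finsetSum _ fun i _ => ((hG i).2 i).1).ae_eq hw.symm

lemma zero : HasLaplacian Ω bc 0 0 := by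
  refine ⟨0, 0, .zero, fun _ => .zero, .of_eq (by ext; simp), ?_⟩
  cases bc
  exacts [.zero, .zero]

lemma add (hu : HasLaplacian Ω bc u w) (hv : HasLaplacian Ω bc v z) :
    HasLaplacian Ω bc (u + v) (w + z) := by
  have hw2 := hu.memLp
  have hz2 := hv.memLp
  obtain ⟨G, K, hu, hG, hw, hubc⟩ := hu
  obtain ⟨H, L, hv, hH, hz, hvbc⟩ := hv
  refine ⟨G + H, K + L, hu.add hv, fun i => (hG i).add (hH i), ?_, ?_⟩
  · filter_upwards [hw, hz] with x hwx hzx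
    simp [hwx, hzx, Finset.sum_add_distrib]
  · cases bc with
    | dirichlet => exact hubc.add hvbc hu hv
    | neumann => exact hubc.add hvbc (fun i => (hG i).1) (fun i => (hH i).1) hw2 hz2

lemma const_smul (c : ℂ) (hu : HasLaplacian Ω bc u w) : HasLaplacian Ω bc (c • u) (c • w) := by
  obtain ⟨G, K, hu, hG, hw, hbc⟩ := hu
  refine ⟨c • G, c • K, hu.const_smul c, fun i => (hG i).const_smul c, ?_, ?_⟩
  · filter_upwards [hw] with x hx
    simp [hx, Finset.mul_sum]
  · cases bc
    exacts [hbc.const_smul c, hbc.const_smul c]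

lemma sum {ι : Type*} (s : Finset ι) {U W : ι → E n → ℂ}
    (h : ∀ j ∈ s, HasLaplacian Ω bc (U j) (W j)) :
    HasLaplacian Ω bc (∑ j ∈ s, U j) (∑ j ∈ s, W j) := by
  induction s using Finset.cons_induction with
  | empty => exact zero
  | cons j s hj ih =>
    rw [Finset.forall_mem_cons] at h
    simpa only [Finset.sum_cons] using h.1.add (ih h.2)

lemma mulVec {ι κ : Type*} [Fintype κ] (C : Matrix ι κ ℂ) {U W : E n → κ → ℂ}
    (h : ∀ j, HasLaplacian Ω bc (U · j) (W · j)) (i : ι) :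
    HasLaplacian Ω bc (fun x => (C *ᵥ U x) i) (fun x => (C *ᵥ W x) i) := by
  convert sum Finset.univ fun j _ => (h j).const_smul (C i j) using 1 <;>
    · ext x
      simp [Matrix.mulVec, dotProduct]

lemma exists_green_star (hu : HasLaplacian Ω bc u w) :
    ∃ G, HasH1Gradient Ω u G ∧
      ∫ x in Ω, ((∑ i, G i x * star (G i x)) + w x * star (u x)) = 0 := by
  have hw2 := hu.memLp
  obtain ⟨G, K, hu, hG, hw, hbc⟩ := hu
  refine ⟨G, hu, ?_⟩
  cases bc with
  | dirichlet => exact hbc.star.integral_green_eq_zero hu.star hG hw hw2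
  | neumann => exact hbc _ _ hu.star

lemma exists_eq_ofReal_nonneg {c : ℂ} (hu : HasLaplacian Ω bc u w)
    (hne : ¬ u =ᵐ[volume.restrict Ω] 0) (hc : ∀ᵐ x ∂volume.restrict Ω, -w x = c * u x) :
    ∃ lam : ℝ, 0 ≤ lam ∧ c = lam := by
  have hw2 := hu.memLp
  obtain ⟨G, hG, hgreen⟩ := hu.exists_green_star
  set S : ℝ := ∑ i, ∫ x in Ω, ‖G i x‖ ^ 2
  set N : ℝ := ∫ x in Ω, ‖u x‖ ^ 2
  have hN : 0 < N := integral_norm_sq_pos hG.1 hne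
  have hS : 0 ≤ S := Finset.sum_nonneg fun i _ => integral_nonneg fun x => sq_nonneg _
  have hmass : ∫ x in Ω, w x * star (u x) = -c * N := by
    calc ∫ x in Ω, w x * star (u x) = ∫ x in Ω, -c * (u x * star (u x)) := by
          refine integral_congr_ae ?_
          filter_upwards [hc] with x hx
          linear_combination -star (u x) * hx
      _ = -c * N := by rw [integral_const_mul, integral_mul_star_self]; rfl
  have hrayleigh : (S : ℂ) = c * N := by
    have h := integral_sum_mul_add_mul (fun i => (hG.2 i).1) (fun i => (hG.2 i).1.star) hw2
      hG.1.star
    simp only [Pi.star_apply] at h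
    rw [hgreen, hmass] at h
    simp only [integral_mul_star_self] at h
    simp only [S, Complex.ofReal_sum]
    linear_combination -h
  refine ⟨S / N, div_nonneg hS hN.le, ?_⟩
  rw [Complex.ofReal_div, hrayleigh, mul_div_cancel_right₀]
  exact_mod_cast hN.ne'

end HasLaplacian

lemma IsLaplaceEigenvalue.nonneg {bc : BoundaryCondition} {lam : ℝ}
    (h : IsLaplaceEigenvalue Ω bc lam) : 0 ≤ lam := by
  obtain ⟨e, w, he, hne, hlam⟩ := h
  obtain ⟨lam', hlam', heq⟩ := he.exists_eq_ofReal_nonneg hne hlam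
  rwa [Complex.ofReal_injective heq]

end Sobolev

section Eigenvector

open Polynomial

variable {α ι K : Type*} [Field K] [IsAlgClosed K] [Fintype ι] [DecidableEq ι]

/-- Strip the linear factors of a polynomial annihilating `U` one at a time: at the factor `X - z`
whose removal leaves a nonzero family, that family consists of eigenvectors for `z`. -/
lemma exists_aeval_mulVec_eigenvector (B : Matrix ι ι K) {l : Filter α} {U : α → ι → K}
    (hU : ∃ᶠ x in l, U x ≠ 0) :
    ∃ (z : K) (q : K[X]), (∃ᶠ x in l, aeval B q *ᵥ U x ≠ 0) ∧
      ∀ᶠ x in l, B *ᵥ aeval B q *ᵥ U x = z • aeval B q *ᵥ U x := by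
  have hsplit := (IsAlgClosed.splits B.charpoly).eq_prod_roots_of_monic B.charpoly_monic
  have hann : ∀ᶠ x in l, aeval B B.charpoly *ᵥ U x = 0 :=
    .of_forall fun x => by rw [Matrix.aeval_self_charpoly, Matrix.zero_mulVec]
  rw [hsplit] at hann
  clear hsplit
  generalize B.charpoly.roots = s at hann
  induction s using Multiset.induction with
  | empty => exact absurd (by simpa using hann) hU
  | cons z s ih =>
    set q := (s.map fun r => X - C r).prod with hq_def
    rw [Multiset.map_cons, Multiset.prod_cons, ← hq_def] at hann
    by_cases hq : ∀ᶠ x in l, aeval B q *ᵥ U x = 0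
    · exact ih hq
    · refine ⟨z, q, not_eventually.1 hq, hann.mono fun x hx => sub_eq_zero.1 ?_⟩
      rw [← hx]
      simp [sub_mul, Matrix.sub_mulVec, Algebra.algebraMap_eq_smul_one, Matrix.smul_mulVec]

end Eigenvector

section PlanarSpectrum

variable {M : Matrix (Fin 2) (Fin 2) ℝ} {z : ℂ}

lemma hasEigenvalue_fin_two_iff {K : Type*} [Field K] {B : Matrix (Fin 2) (Fin 2) K} {z : K} :
    Module.End.HasEigenvalue (Matrix.toLin' B) z ↔ z ^ 2 - B.trace * z + B.det = 0 := by
  rw [Module.End.hasEigenvalue_iff_isRoot_charpoly, Matrix.charpoly_toLin', Matrix.charpoly_fin_two]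
  simp

lemma hasEigenvalue_map_ofReal_iff :
    Module.End.HasEigenvalue (Matrix.toLin' (M.map (algebraMap ℝ ℂ))) z ↔
      z ^ 2 - M.trace * z + M.det = 0 := by
  simp [hasEigenvalue_fin_two_iff, Matrix.det_fin_two, Matrix.trace_fin_two]

lemma det_eq_of_eigenvalue_re_nonneg (htr : M.trace < 0)
    (hz : Module.End.HasEigenvalue (Matrix.toLin' (M.map (algebraMap ℝ ℂ))) z) (hre : 0 ≤ z.re) :
    M.det = z.re * (M.trace - z.re) := by
  rw [hasEigenvalue_map_ofReal_iff] at hz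
  have him : z.im * (2 * z.re - M.trace) = 0 := by
    have := congrArg Complex.im hz
    simp only [pow_two, Complex.add_im, Complex.sub_im, Complex.mul_im, Complex.ofReal_re,
      Complex.ofReal_im, zero_mul, add_zero, Complex.zero_im] at this
    linarith
  have hreal : z.im = 0 := (mul_eq_zero.1 him).resolve_right (by linarith)
  have := congrArg Complex.re hz
  simp only [pow_two, Complex.add_re, Complex.sub_re, Complex.mul_re, hreal, mul_zero, sub_zero,
    Complex.ofReal_re, Complex.ofReal_im, Complex.zero_re] at this
  linarith

lemma eigenvalue_re_neg_of_trace_neg_of_det_pos (htr : M.trace < 0) (hdet : 0 < M.det)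
    (hz : Module.End.HasEigenvalue (Matrix.toLin' (M.map (algebraMap ℝ ℂ))) z) : z.re < 0 := by
  by_contra! hre
  refine hdet.not_ge ?_
  rw [det_eq_of_eigenvalue_re_nonneg htr hz hre]
  exact mul_nonpos_of_nonneg_of_nonpos hre (by linarith)

lemma exists_eigenvalue_re_pos_iff_det_neg (htr : M.trace < 0) :
    (∃ z : ℂ, Module.End.HasEigenvalue (Matrix.toLin' (M.map (algebraMap ℝ ℂ))) z ∧ 0 < z.re) ↔
      M.det < 0 := by
  constructor
  · rintro ⟨z, hz, hre⟩
    rw [det_eq_of_eigenvalue_re_nonneg htr hz hre.le]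
    exact mul_neg_of_pos_of_neg hre (by linarith)
  · intro hdet
    have hsq := Real.sq_sqrt (show 0 ≤ M.trace ^ 2 - 4 * M.det by nlinarith)
    set s := √(M.trace ^ 2 - 4 * M.det)
    have hs : -M.trace < s := Real.lt_sqrt_of_sq_lt (by linarith [neg_sq M.trace])
    refine ⟨((M.trace + s) / 2 : ℝ), hasEigenvalue_map_ofReal_iff.2 ?_, ?_⟩
    · norm_cast
      linear_combination hsq / 4
    · rw [Complex.ofReal_re]
      linarith

end PlanarSpectrum

section ModePolynomial

variable {A : Matrix (Fin 2) (Fin 2) ℝ} {Du d r lam : ℝ}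

lemma det_modeMatrix (A : Matrix (Fin 2) (Fin 2) ℝ) (Du Dv lam : ℝ) :
    (modeMatrix A Du Dv lam).det = hPoly A Du Dv lam := by
  rw [modeMatrix, hPoly, Matrix.det_fin_two_of, Matrix.det_fin_two]
  ring

lemma trace_modeMatrix (A : Matrix (Fin 2) (Fin 2) ℝ) (Du Dv lam : ℝ) :
    (modeMatrix A Du Dv lam).trace = A.trace - lam * (Du + Dv) := by
  rw [modeMatrix, Matrix.trace_fin_two_of, Matrix.trace_fin_two]
  ring

lemma ordConnected_setOf_hPoly_neg (hDu : 0 ≤ Du) (hd : 0 ≤ d) :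
    {lam | hPoly A Du d lam < 0}.OrdConnected := by
  have hconv : ConvexOn ℝ Set.univ (hPoly A Du d) := by
    have hsq := (even_two.convexOn_pow (𝕜 := ℝ)).smul (mul_nonneg hDu hd)
    have hlin := (-((A 0 0 * d + A 1 1 * Du) • (LinearMap.id : ℝ →ₗ[ℝ] ℝ))).convexOn convex_univ
    refine ((hsq.add hlin).add_const A.det).congr fun lam _ => ?_
    simp [hPoly, sub_eq_add_neg]
  simpa using (hconv.convex_lt 0).ordConnected

lemma hPoly_zero_pos (hdet : 0 < A.det) (hA11 : A 1 1 ≤ 0) (hDu : 0 ≤ Du) (hlam : 0 ≤ lam) :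
    0 < hPoly A Du 0 lam := by
  have := mul_nonpos_of_nonpos_of_nonneg (mul_nonpos_of_nonpos_of_nonneg hA11 hDu) hlam
  simp only [hPoly]
  linarith

/-- `d ↦ h_d(λ)` is affine, hence decreasing as soon as it goes from positive to nonpositive. -/
lemma hPoly_neg_of_lt (h0 : 0 < hPoly A Du 0 lam) (hr : 0 < r) (hrd : r < d)
    (h : hPoly A Du r lam ≤ 0) : hPoly A Du d lam < 0 := by
  have hsecant : r * hPoly A Du d lam = d * hPoly A Du r lam - (d - r) * hPoly A Du 0 lam := by
    simp only [hPoly]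
    ring
  have hd := hr.trans hrd
  refine neg_of_mul_neg_right (a := r) ?_ hr.le
  rw [hsecant]
  linarith [mul_nonpos_of_nonneg_of_nonpos hd.le h, mul_pos (sub_pos.2 hrd) h0]

lemma dvRoot_lt_iff (h0 : 0 < hPoly A Du 0 lam) (hd : 0 < d) :
    DvRoot A Du lam < d ↔ hPoly A Du d lam < 0 := by
  simp only [DvRoot, sInf_lt_iff, Set.exists_mem_image, Set.mem_ofPred_eq, EReal.coe_lt_coe_iff]
  constructor
  · rintro ⟨r, ⟨hr, hroot⟩, hrd⟩
    exact hPoly_neg_of_lt h0 hr hrd hroot.le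
  · intro hneg
    have hcont : Continuous fun d => hPoly A Du d lam := by
      unfold hPoly
      fun_prop
    obtain ⟨r, ⟨hr, hrd⟩, hroot⟩ :=
      intermediate_value_Ioo' hd.le hcont.continuousOn ⟨hneg, h0⟩
    exact ⟨r, ⟨hr, hroot⟩, hrd⟩

end ModePolynomial

section CriticalDiffusion

variable {A : Matrix (Fin 2) (Fin 2) ℝ} {Du d lam : ℝ}

lemma A00_ne_zero_of_Dv0_pos (hDv0 : 0 < Dv0 A Du) : A 0 0 ≠ 0 := by
  intro h
  simp [Dv0, h] at hDv0

lemma kc0_pos_iff (hDu : 0 < Du) (hDv0 : 0 < Dv0 A Du) :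
    0 < kc0 A Du ↔ 0 < A 0 0 * Dv0 A Du + A 1 1 * Du :=
  div_pos_iff_of_pos_right (by positivity)

lemma Dv0_isRoot (hdet : 0 ≤ A.det) (hA : A 0 0 * A 1 1 ≤ 0) (hA00 : A 0 0 ≠ 0) :
    A 0 0 ^ 2 * (Dv0 A Du * Dv0 A Du) + -qCoeff A Du * Dv0 A Du + (A 1 1 * Du) ^ 2 = 0 := by
  have hdisc : discrim (A 0 0 ^ 2) (-qCoeff A Du) ((A 1 1 * Du) ^ 2) =
      (4 * Du) ^ 2 * (A.det * (A.det - A 0 0 * A 1 1)) := by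
    simp only [discrim, qCoeff]
    ring
  have hnonneg : 0 ≤ discrim (A 0 0 ^ 2) (-qCoeff A Du) ((A 1 1 * Du) ^ 2) := by
    rw [hdisc]
    exact mul_nonneg (sq_nonneg _) (mul_nonneg hdet (by linarith))
  refine (quadratic_eq_zero_iff (pow_ne_zero 2 hA00) (Real.mul_self_sqrt hnonneg).symm _).2
    (Or.inl ?_)
  rw [Dv0, neg_neg, discrim]
  ring_nf

/-- `D_v⁰` is the larger root, and the two roots have the product `(a₂₂ D_u / a₁₁)²`. -/
lemma sq_le_sq_mul_Dv0 (hdet : 0 ≤ A.det) (hA : A 0 0 * A 1 1 ≤ 0) (hDv0 : 0 < Dv0 A Du) :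
    (A 1 1 * Du) ^ 2 ≤ (A 0 0 * Dv0 A Du) ^ 2 := by
  have hA00 := A00_ne_zero_of_Dv0_pos hDv0
  have hlarger : qCoeff A Du ≤ Dv0 A Du * (2 * A 0 0 ^ 2) := by
    rw [Dv0, div_mul_cancel₀ _ (by positivity)]
    exact le_add_of_nonneg_right (Real.sqrt_nonneg _)
  linarith [Dv0_isRoot (Du := Du) hdet hA hA00, mul_le_mul_of_nonneg_right hlarger hDv0.le]

lemma A11_neg (hdet : 0 < A.det) (htr : A.trace < 0) (hDu : 0 < Du) (hDv0 : 0 < Dv0 A Du)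
    (hk : 0 < kc0 A Du) : A 1 1 < 0 := by
  rw [Matrix.trace_fin_two] at htr
  rw [kc0_pos_iff hDu hDv0] at hk
  by_contra! hA11
  have hA00 : A 0 0 < 0 := by linarith
  refine (sq_le_sq_mul_Dv0 hdet.le (mul_nonpos_of_nonpos_of_nonneg hA00.le hA11) hDv0).not_gt ?_
  rw [sq_lt_sq, abs_of_neg (mul_neg_of_neg_of_pos hA00 hDv0),
    abs_of_nonneg (mul_nonneg hA11 hDu.le)]
  linarith

/-- At `D_v⁰` the discriminant of `h` vanishes, so its vertex `k_c⁰` is a double root. -/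
lemma hPoly_Dv0 (hdet : 0 ≤ A.det) (hA : A 0 0 * A 1 1 ≤ 0) (hDu : Du ≠ 0)
    (hDv0 : Dv0 A Du ≠ 0) (hA00 : A 0 0 ≠ 0) (lam : ℝ) :
    hPoly A Du (Dv0 A Du) lam = Du * Dv0 A Du * (lam - kc0 A Du) ^ 2 := by
  have hdisc : (A 0 0 * Dv0 A Du + A 1 1 * Du) ^ 2 = 4 * Du * Dv0 A Du * A.det := by
    have hroot := Dv0_isRoot (Du := Du) hdet hA hA00
    rw [qCoeff] at hroot
    linear_combination hroot
  simp only [hPoly, kc0]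
  field_simp
  linear_combination -hdisc

lemma hPoly_kc0_neg (hdet : 0 < A.det) (htr : A.trace < 0) (hDu : 0 < Du) (hDv0 : 0 < Dv0 A Du)
    (hk : 0 < kc0 A Du) (hd : 0 < d) (hlam : 0 ≤ lam) (hneg : hPoly A Du d lam < 0) :
    hPoly A Du d (kc0 A Du) < 0 := by
  have hA11 := A11_neg hdet htr hDu hDv0 hk
  have hA00 : 0 < A 0 0 := by
    refine pos_of_mul_pos_left (b := Dv0 A Du) ?_ hDv0.le
    linarith [(kc0_pos_iff hDu hDv0).1 hk, mul_neg_of_neg_of_pos hA11 hDu]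
  have hsq := hPoly_Dv0 hdet.le (mul_nonpos_of_nonneg_of_nonpos hA00.le hA11.le) hDu.ne' hDv0.ne'
    hA00.ne'
  have hDv0_le : 0 ≤ hPoly A Du (Dv0 A Du) lam := by
    rw [hsq]
    positivity
  have hDv0_lt : Dv0 A Du < d := by
    by_contra! hle
    rcases hle.eq_or_lt with rfl | hlt
    · exact hneg.not_ge hDv0_le
    · have h0 := hPoly_zero_pos hdet hA11.le hDu.le hlam
      exact (hPoly_neg_of_lt h0 hd hlt hneg.le).not_ge hDv0_le
  refine hPoly_neg_of_lt (hPoly_zero_pos hdet hA11.le hDu.le hk.le) hDv0 hDv0_lt ?_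
  rw [hsq]
  simp

end CriticalDiffusion

section Linearization

variable {n : ℕ} {Ω : Set (E n)} {bc : BoundaryCondition}

lemma exists_laplaceEigenvalue_hasEigenvalue_neg {ι : Type*} [Fintype ι] [DecidableEq ι]
    {B : Matrix ι ι ℂ} {U W : E n → ι → ℂ} (hL : ∀ j, HasLaplacian Ω bc (U · j) (W · j))
    (hU : ¬ U =ᵐ[volume.restrict Ω] 0) (hW : ∀ᵐ x ∂volume.restrict Ω, W x = B *ᵥ U x) :
    ∃ lam : ℝ, IsLaplaceEigenvalue Ω bc lam ∧
      Module.End.HasEigenvalue (Matrix.toLin' B) (-lam : ℂ) := by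
  obtain ⟨z, q, hne, hz⟩ := exists_aeval_mulVec_eigenvector B (not_eventually.1 hU)
  set C := Polynomial.aeval B q
  have hcomm : C * B = B * C := by
    simpa using congrArg (Polynomial.aeval B) (mul_comm q Polynomial.X)
  obtain ⟨i, hi⟩ : ∃ i, ¬ (fun x => (C *ᵥ U x) i) =ᵐ[volume.restrict Ω] 0 := by
    by_contra! h
    exact hne ((eventually_all.2 h).mono fun x hx => not_not.2 (funext hx))
  have hlap : ∀ᵐ x ∂volume.restrict Ω, -(C *ᵥ W x) i = -z * (C *ᵥ U x) i := by
    filter_upwards [hW, hz] with x hWx hzx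
    rw [hWx, Matrix.mulVec_mulVec, hcomm, ← Matrix.mulVec_mulVec, hzx, Pi.smul_apply, smul_eq_mul,
      neg_mul]
  obtain ⟨lam, -, hlam⟩ := (HasLaplacian.mulVec C hL i).exists_eq_ofReal_nonneg hi hlap
  refine ⟨lam, ⟨_, _, HasLaplacian.mulVec C hL i, hi, by rwa [← hlam]⟩, ?_⟩
  obtain ⟨x, hx, hBx⟩ := (hne.and_eventually hz).exists
  refine Module.End.hasEigenvalue_of_hasEigenvector (x := C *ᵥ U x)
    (Module.End.hasEigenvector_iff.2 ⟨?_, hx⟩)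
  rw [Module.End.mem_eigenspace_iff, Matrix.toLin'_apply, hBx, ← hlam, neg_neg]

lemma IsLaplaceEigenvalue.exists_hasLaplacian_mulVec {ι : Type*} [Fintype ι] [DecidableEq ι]
    {B : Matrix ι ι ℂ} {lam : ℝ} (hlam : IsLaplaceEigenvalue Ω bc lam)
    (hB : Module.End.HasEigenvalue (Matrix.toLin' B) (-lam : ℂ)) :
    ∃ U W : E n → ι → ℂ, (∀ j, HasLaplacian Ω bc (U · j) (W · j)) ∧
      ¬ U =ᵐ[volume.restrict Ω] 0 ∧ ∀ᵐ x ∂volume.restrict Ω, W x = B *ᵥ U x := by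
  obtain ⟨e, w, he, hne, hew⟩ := hlam
  obtain ⟨c, hc⟩ := hB.exists_hasEigenvector
  have hBc : B *ᵥ c = (-lam : ℂ) • c := by simpa using hc.apply_eq_smul
  refine ⟨fun x => e x • c, fun x => w x • c, fun j => ?_, fun h => hne ?_, ?_⟩
  · simpa only [Pi.smul_def, smul_eq_mul, mul_comm (c j)] using he.const_smul (c j)
  · exact h.mono fun x hx => (smul_eq_zero.1 hx).resolve_right hc.2
  · filter_upwards [hew] with x hx
    have hwx : w x = e x * -lam := by linear_combination -hx
    rw [Matrix.mulVec_smul, hBc, smul_smul, hwx]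

/-- The matrix `D⁻¹(β - A)` with `D = diag(Du, Dv)`: it expresses the eigenvalue equation
`D ΔU + A U = β U` of the linearization as `ΔU = D⁻¹(β - A) U`. -/
noncomputable def laplacianMatrix (A : Matrix (Fin 2) (Fin 2) ℝ) (Du Dv : ℝ) (β : ℂ) :
    Matrix (Fin 2) (Fin 2) ℂ :=
  !![(β - A 0 0) / Du, -A 0 1 / Du; -A 1 0 / Dv, (β - A 1 1) / Dv]

variable {A : Matrix (Fin 2) (Fin 2) ℝ} {Du Dv : ℝ} {β : ℂ}

lemma eq_laplacianMatrix_mulVec_iff (hDu : Du ≠ 0) (hDv : Dv ≠ 0) {U W : Fin 2 → ℂ} :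
    W = laplacianMatrix A Du Dv β *ᵥ U ↔
      (Du : ℂ) * W 0 + (A 0 0 : ℂ) * U 0 + (A 0 1 : ℂ) * U 1 = β * U 0 ∧
      (Dv : ℂ) * W 1 + (A 1 0 : ℂ) * U 0 + (A 1 1 : ℂ) * U 1 = β * U 1 := by
  have hDu' : (Du : ℂ) ≠ 0 := Complex.ofReal_ne_zero.2 hDu
  have hDv' : (Dv : ℂ) ≠ 0 := Complex.ofReal_ne_zero.2 hDv
  rw [funext_iff, Fin.forall_fin_two]
  simp only [laplacianMatrix, Matrix.mulVec, dotProduct, Fin.sum_univ_two, Matrix.of_apply,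
    Matrix.cons_val', Matrix.cons_val_zero, Matrix.cons_val_one, Matrix.cons_val_fin_one]
  field_simp
  constructor <;> rintro ⟨h0, h1⟩ <;> constructor <;>
    first | linear_combination h0 | linear_combination h1

lemma hasEigenvalue_modeMatrix_iff (hDu : Du ≠ 0) (hDv : Dv ≠ 0) {lam : ℝ} :
    Module.End.HasEigenvalue (Matrix.toLin' ((modeMatrix A Du Dv lam).map (algebraMap ℝ ℂ))) β ↔
      Module.End.HasEigenvalue (Matrix.toLin' (laplacianMatrix A Du Dv β)) (-lam : ℂ) := by
  have hDu' : (Du : ℂ) ≠ 0 := Complex.ofReal_ne_zero.2 hDu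
  have hDv' : (Dv : ℂ) ≠ 0 := Complex.ofReal_ne_zero.2 hDv
  have hcharpoly : β ^ 2 - (modeMatrix A Du Dv lam).trace * β + (modeMatrix A Du Dv lam).det =
      Du * Dv * ((-lam) ^ 2 - (laplacianMatrix A Du Dv β).trace * (-lam) +
        (laplacianMatrix A Du Dv β).det) := by
    simp only [modeMatrix, laplacianMatrix, Matrix.trace_fin_two_of, Matrix.det_fin_two_of]
    push_cast
    field_simp
    ring
  rw [hasEigenvalue_map_ofReal_iff, hasEigenvalue_fin_two_iff, hcharpoly,
    mul_eq_zero_iff_left (mul_ne_zero hDu' hDv')]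

lemma isLinearizationEigenvalue_iff_exists_vector (hDu : Du ≠ 0) (hDv : Dv ≠ 0) :
    IsLinearizationEigenvalue Ω bc A Du Dv β ↔
      ∃ U W : E n → Fin 2 → ℂ, (∀ j, HasLaplacian Ω bc (U · j) (W · j)) ∧
        ¬ U =ᵐ[volume.restrict Ω] 0 ∧
        ∀ᵐ x ∂volume.restrict Ω, W x = laplacianMatrix A Du Dv β *ᵥ U x := by
  have hzero {U : E n → Fin 2 → ℂ} : U =ᵐ[volume.restrict Ω] 0 ↔
      (U · 0) =ᵐ[volume.restrict Ω] 0 ∧ (U · 1) =ᵐ[volume.restrict Ω] 0 := by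
    simp only [EventuallyEq, ← eventually_and, funext_iff, Fin.forall_fin_two, Pi.zero_apply]
  simp only [eq_laplacianMatrix_mulVec_iff hDu hDv, hzero, Fin.forall_fin_two]
  constructor
  · rintro ⟨u, v, wu, wv, hu, hv, hne, heq⟩
    exact ⟨fun x => ![u x, v x], fun x => ![wu x, wv x], ⟨hu, hv⟩, hne, heq⟩
  · rintro ⟨U, W, ⟨hu, hv⟩, hne, heq⟩
    exact ⟨_, _, _, _, hu, hv, hne, heq⟩

lemma isLinearizationEigenvalue_iff (hDu : Du ≠ 0) (hDv : Dv ≠ 0) :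
    IsLinearizationEigenvalue Ω bc A Du Dv β ↔ ∃ lam : ℝ, IsLaplaceEigenvalue Ω bc lam ∧
      Module.End.HasEigenvalue
        (Matrix.toLin' ((modeMatrix A Du Dv lam).map (algebraMap ℝ ℂ))) β := by
  simp only [isLinearizationEigenvalue_iff_exists_vector hDu hDv,
    hasEigenvalue_modeMatrix_iff hDu hDv]
  constructor
  · rintro ⟨U, W, hL, hU, hW⟩
    exact exists_laplaceEigenvalue_hasEigenvalue_neg hL hU hW
  · rintro ⟨lam, hlam, hβ⟩
    exact hlam.exists_hasLaplacian_mulVec hβ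

lemma exists_linearizationEigenvalue_re_pos_iff (htr : A.trace < 0) (hDu : 0 < Du)
    (hDv : 0 < Dv) :
    (∃ β : ℂ, IsLinearizationEigenvalue Ω bc A Du Dv β ∧ 0 < β.re) ↔
      ∃ lam, IsLaplaceEigenvalue Ω bc lam ∧ hPoly A Du Dv lam < 0 := by
  have htrace {lam : ℝ} (hlam : IsLaplaceEigenvalue Ω bc lam) :
      (modeMatrix A Du Dv lam).trace < 0 := by
    rw [trace_modeMatrix]
    linarith [mul_nonneg hlam.nonneg (add_pos hDu hDv).le]
  simp only [isLinearizationEigenvalue_iff hDu.ne' hDv.ne', ← det_modeMatrix]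
  constructor
  · rintro ⟨β, ⟨lam, hlam, hβ⟩, hre⟩
    exact ⟨lam, hlam, (exists_eigenvalue_re_pos_iff_det_neg (htrace hlam)).1 ⟨β, hβ, hre⟩⟩
  · rintro ⟨lam, hlam, hneg⟩
    obtain ⟨β, hβ, hre⟩ := (exists_eigenvalue_re_pos_iff_det_neg (htrace hlam)).2 hneg
    exact ⟨β, ⟨lam, hlam, hβ⟩, hre⟩

end Linearization

end TuringRD

open TuringRD in
theorem theorem4p4_general {n : ℕ} (Ω : Set (E n)) (bc : BoundaryCondition)
    (A : Matrix (Fin 2) (Fin 2) ℝ) (hdet : 0 < A.det) (htr : A.trace < 0)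
    (Du : ℝ) (hDu : 0 < Du) (hDv0 : 0 < Dv0 A Du)
    (lam lam' : ℝ) (hlam : AreConsecutiveEigenvalues Ω bc lam lam')
    (hk : lam < kc0 A Du) (hk' : kc0 A Du < lam') (Dv : ℝ) (hDv : 0 < Dv) :
    (∃ β : ℂ, IsLinearizationEigenvalue Ω bc A Du Dv β ∧ 0 < β.re) ↔
      DvStar A Du lam lam' < (Dv : EReal) := by
  obtain ⟨hev, hev', -, hgap⟩ := hlam
  have hkpos : 0 < kc0 A Du := hev.nonneg.trans_lt hk
  have hA11 : A 1 1 < 0 := A11_neg hdet htr hDu hDv0 hkpos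
  have hroot {μ : ℝ} (hμ : IsLaplaceEigenvalue Ω bc μ) :
      DvRoot A Du μ < Dv ↔ hPoly A Du Dv μ < 0 :=
    dvRoot_lt_iff (hPoly_zero_pos hdet hA11.le hDu.le hμ.nonneg) hDv
  rw [exists_linearizationEigenvalue_re_pos_iff htr hDu hDv, DvStar, min_lt_iff, hroot hev,
    hroot hev']
  refine ⟨?_, fun h => h.elim (⟨lam, hev, ·⟩) (⟨lam', hev', ·⟩)⟩
  rintro ⟨μ, hμ, hneg⟩
  have hkneg : hPoly A Du Dv (kc0 A Du) < 0 :=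
    hPoly_kc0_neg hdet htr hDu hDv0 hkpos hDv hμ.nonneg hneg
  have hconn := ordConnected_setOf_hPoly_neg (A := A) hDu.le hDv.le
  exact (hgap μ hμ).imp (fun hle => hconn.out hneg hkneg ⟨hle, hk.le⟩)
    (fun hge => hconn.out hkneg hneg ⟨hk'.le, hge⟩)

theorem theorem4p4 {n : ℕ} (Ω : Set (TuringRD.E n)) (hΩo : IsOpen Ω) (hΩc : IsConnected Ω)
    (hΩb : Bornology.IsBounded Ω) (bc : TuringRD.BoundaryCondition)
    (f g : ℝ → ℝ → ℝ) (hf0 : f 0 0 = 0) (hg0 : g 0 0 = 0)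
    (hf : DifferentiableAt ℝ (Function.uncurry f) (0, 0))
    (hg : DifferentiableAt ℝ (Function.uncurry g) (0, 0))
    (A : Matrix (Fin 2) (Fin 2) ℝ) (hA : A = TuringRD.jacobian f g)
    (hdet : 0 < A.det) (htr : A.trace < 0)
    (Du : ℝ) (hDu : 0 < Du) (hDv0 : 0 < TuringRD.Dv0 A Du)
    (lam lam' : ℝ) (hlam : TuringRD.AreConsecutiveEigenvalues Ω bc lam lam')
    (hk : lam < TuringRD.kc0 A Du) (hk' : TuringRD.kc0 A Du < lam')
    (hM : 0 < (TuringRD.modeMatrix A Du (TuringRD.Dv0 A Du) lam).det)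
    (hM' : 0 < (TuringRD.modeMatrix A Du (TuringRD.Dv0 A Du) lam').det) :
    ∀ Dv : ℝ, 0 < Dv →
      (TuringRD.IsTuringUnstable Ω bc f g Du Dv ↔
        TuringRD.DvStar A Du lam lam' < (Dv : EReal)) := by
  subst hA
  intro Dv hDv
  have hstable : TuringRD.IsKineticallyStable f g := fun z hz =>
    TuringRD.eigenvalue_re_neg_of_trace_neg_of_det_pos htr hdet hz
  exact (and_iff_right hstable).trans <|
    theorem4p4_general Ω bc _ hdet htr Du hDu hDv0 lam lam' hlam hk hk' Dv hDv
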